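/- Let $\mathbb{P}$ be the set of positive integers and $\mathbb{P}^*$ the set of finite words over $\mathbb{P}$. For $w=w_1\cdots w_m\in\mathbb{P}^*$ put $|w|=m$, $\|w\|=w_1+\cdots+w_m$ and $\tilde w=w_m\cdots w_1$ (the reversal of $w$). For $u,w\in\mathbb{P}^*$ let $Em(u,w)$ be the set of all indices $j\ge 1$ such that $w$ has a factor $v$ with $|v|=|u|$ that starts at the $j$-th letter of $w$ and satisfies $u_i\le v_i$ for all $1\le i\le |u|$. Two words $u,v$ are super-strongly Wilf equivalent if there is a bijection $f:\mathbb{P}^*\to\mathbb{P}^*$ with $|f(w)|=|w|$, $\|f(w)\|=\|w\|$ and $Em(u,w)=Em(v,f(w))$ for all $w\in\mathbb{P}^*$. The skyline diagram of a word $u=u_1\cdots u_m$ is the figure formed by $m$ adjacent columns of squares, the $i$-th of which consists of $u_i$ squares. A rigid shift of $u$ is any word that is formed by cutting the skyline diagram of $u$ at some height $h$ and rigidly moving together all blocks above the cut, in such a way that each moved column comes to rest on a column whose height after the cut is $h$. Two words are shift equivalent if one can be obtained from the other by a finite sequence of rigid shifts and reversals. Let $\mathcal{S}_n$ be the set of words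 that contain each of the letters $1,\dots,n$ exactly once and no other letter (the permutations of $1,\dots,n$). Let $s_n$ be the number of super-strong Wilf equivalence classes of $\mathcal{S}_n$, and let $sh_n$ be the number of shift equivalence classes of $\mathcal{S}_n$. Then, for every $n\ge 3$, $$ sh_n = 1+\frac{s_n}{2}. $$ -/

import Mathlib

namespace WilfShift

/-- Words over the alphabet of positive integers, the empty word included. -/
abbrev Word : Type := List ℕ+

/-- The norm of a word: the sum of its letters. -/
def norm (w : Word) : ℕ := (w.map (fun a : ℕ+ => (a : ℕ))).sum

/-- The embedding index set of `u` into `w`: all (one-based) positions `j` at which `w` has a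
factor `v` of the same length as `u` that dominates `u` letter by letter. -/
def Em (u w : Word) : Set ℕ :=
  {j | ∃ s v t : Word, w = s ++ v ++ t ∧ j = s.length + 1 ∧ List.Forall₂ (fun a b => a ≤ b) u v}

/-- Super-strong Wilf equivalence: some bijection of the set of all words preserves the weight
(length and norm) and carries embedding index sets of `u` to embedding index sets of `v`. -/
def SSWilf (u v : Word) : Prop :=
  ∃ f : Word ≃ Word,
    (∀ w, (f w).length = w.length ∧ norm (f w) = norm w) ∧ ∀ w, Em u w = Em v (f w)

/-- The height of the column at position `i` of the skyline diagram of `u`: the (zero-based)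
`i`-th letter of `u`, and `0` at every position that carries no column. -/
def column (u : Word) (i : ℤ) : ℕ :=
  if 0 ≤ i then (u.map (fun a : ℕ+ => (a : ℕ))).getD i.toNat 0 else 0

/-- `v` is a rigid shift of `u`: the skyline diagram of `u` is cut at some height `h ≥ 1`
(a cut at height `0` moves the whole diagram, and it allows the trivial shift only), and all
blocks above the cut are moved together by `k` places. The column cut off at position `i`
(there is one exactly when `h < column u i`) has to come to rest on a column of the diagram
whose height, after the cut, is `h`. The column of `v` at position `j` then consists of what
the cut left there, `min (column u j) h`, and of the blocks that arrive from `j - k`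
(truncated subtraction). -/
def RigidShift (u v : Word) : Prop :=
  ∃ (h : ℕ) (k : ℤ),
    0 < h ∧ (∀ i : ℤ, h < column u i → min (column u (i + k)) h = h) ∧
    ∀ j : ℤ, column v j = min (column u j) h + (column u (j - k) - h)

/-- Shift equivalence: `v` is obtained from `u` by a finite sequence of rigid shifts and
reversals. -/
def ShiftEquiv : Word → Word → Prop :=
  Relation.ReflTransGen (fun a b => RigidShift a b ∨ b = a.reverse)

/-- The words that are permutations of `1, …, n`. -/
def IsPermutation (n : ℕ) (w : Word) : Prop :=
  w.Nodup ∧ ∀ a : ℕ+, a ∈ w ↔ (a : ℕ) ≤ n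

/-- The symmetric group on `n` letters, as a set of words (one-line notation). -/
abbrev PermWord (n : ℕ) : Type := {w : Word // IsPermutation n w}

theorem SSWilf.equivalence : Equivalence SSWilf where
  refl _ := ⟨Equiv.refl _, fun _ => ⟨rfl, rfl⟩, fun _ => rfl⟩
  symm := by
    rintro u v ⟨f, hf, hE⟩
    refine ⟨f.symm, fun w => ?_, fun w => ?_⟩
    · have := hf (f.symm w)
      rw [f.apply_symm_apply] at this
      exact ⟨this.1.symm, this.2.symm⟩
    · have := hE (f.symm w)
      rw [f.apply_symm_apply] at this
      exact this.symm
  trans := by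
    rintro u v w ⟨f, hf, hE⟩ ⟨g, hg, hF⟩
    exact ⟨f.trans g,
      fun x => ⟨(hg (f x)).1.trans (hf x).1, (hg (f x)).2.trans (hf x).2⟩,
      fun x => (hE x).trans (hF (f x))⟩

theorem RigidShift.symm {u v : Word} (H : RigidShift u v) : RigidShift v u := by
  obtain ⟨h, k, h0, h1, h2⟩ := H
  refine ⟨h, -k, h0, fun i hi => ?_, fun j => ?_⟩
  · have e1 := h2 i
    have e2 := h2 (i + -k)
    have e3 : i - k = i + -k := by ring
    rw [e3] at e1
    omega
  · have e1 := h2 j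
    have e2 := h2 (j - -k)
    have e3 : j - -k - k = j := by ring
    have e4 : j - -k = j + k := by ring
    have e5 : j - k + k = j := by ring
    have l1 := h1 j
    have l2 := h1 (j - k)
    rw [e3] at e2
    rw [e4] at e2 ⊢
    rw [e5] at l2
    omega

theorem ShiftEquiv.equivalence : Equivalence ShiftEquiv where
  refl _ := Relation.ReflTransGen.refl
  symm := by
    intro u v H
    induction H with
    | refl => exact Relation.ReflTransGen.refl
    | tail _ h ih =>
      refine Relation.ReflTransGen.head ?_ ih
      rcases h with h | h
      · exact Or.inl h.symm
      · exact Or.inr (by rw [h, List.reverse_reverse])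
  trans := Relation.ReflTransGen.trans

/-- Super-strong Wilf equivalence on the symmetric group. -/
def ssWilfSetoid (n : ℕ) : Setoid (PermWord n) where
  r u v := SSWilf u.1 v.1
  iseqv := ⟨fun u => SSWilf.equivalence.refl u.1, fun h => SSWilf.equivalence.symm h,
    fun h h' => SSWilf.equivalence.trans h h'⟩

/-- Shift equivalence on the symmetric group. -/
def shiftSetoid (n : ℕ) : Setoid (PermWord n) where
  r u v := ShiftEquiv u.1 v.1
  iseqv := ⟨fun u => ShiftEquiv.equivalence.refl u.1, fun h => ShiftEquiv.equivalence.symm h,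
    fun h h' => ShiftEquiv.equivalence.trans h h'⟩

/-- The number of super-strong Wilf equivalence classes of the symmetric group. -/
noncomputable def numSSWilfClasses (n : ℕ) : ℕ := Nat.card (Quotient (ssWilfSetoid n))

/-- The number of shift equivalence classes of the symmetric group. -/
noncomputable def numShiftClasses (n : ℕ) : ℕ := Nat.card (Quotient (shiftSetoid n))

end WilfShift

namespace WilfShift

/-! Everything is reduced to the level sets of a word, the positions carrying letters at least `i`.
A rigid shift translates all levels above the cut by one common vector and fixes the others.
Conversely, levels that are translates can be aligned from the bottom up by rigid shifts. Hence, at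
equal length, shift equivalence is `LevelEquiv` up to one reversal (`shiftEquiv_iff`).

For permutations super-strong Wilf equivalence is exactly `LevelEquiv` (`IsPermutation.ssWilf_iff`).
The least norm of a word of given length that embeds `u` at prescribed places counts the cells of a
union of shifted skylines. A Wilf bijection preserves these counts, and by inclusion-exclusion they
determine the levels up to translation once the level sizes agree (`levelEquiv_of_card_biUnion`). In
the other direction, translating rows preserves the counts, and exchanging one union of skylines for
the other below a word gives the bijection (`LevelEquiv.ssWilf`).

So reversal is an involution on the Wilf classes whose orbits are the shift classes. A fixed class
has all levels symmetric under reflections, which leaves only two shapes, `Straight` and `Gapped`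
(`IsPermutation.straight_or_gapped`). Counting orbits of an involution with two fixed points gives
`s_n + 2 = 2 sh_n`. -/

/-! ### Columns of skyline diagrams. -/

theorem column_natCast (u : Word) (k : ℕ) :
    column u k = (u.map (fun a : ℕ+ => (a : ℕ))).getD k 0 := by
  simp [column]

theorem column_of_neg (u : Word) {x : ℤ} (hx : x < 0) : column u x = 0 := by
  simp [column, not_le.2 hx]

theorem column_getElem (u : Word) (k : ℕ) (hk : k < u.length) : column u k = (u[k] : ℕ) := by
  rw [column_natCast, List.getD_eq_getElem _ _ (by simpa using hk)]
  simp

theorem column_of_length_le (u : Word) {x : ℤ} (hx : (u.length : ℤ) ≤ x) : column u x = 0 := by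
  lift x to ℕ using by omega
  rw [column_natCast, List.getD_eq_default]
  simpa using hx

theorem column_pos_iff (u : Word) (x : ℤ) : 0 < column u x ↔ 0 ≤ x ∧ x < u.length := by
  constructor
  · intro h
    by_contra! hc
    rcases lt_or_ge x 0 with h0 | h0
    · simp [column_of_neg u h0] at h
    · simp [column_of_length_le u (hc h0)] at h
  · rintro ⟨h0, h1⟩
    lift x to ℕ using h0
    rw [column_getElem u x (by omega)]
    exact PNat.pos _

theorem column_ext {u v : Word} (h : ∀ x, column u x = column v x) : u = v := by
  have key : ∀ x : ℤ, (0 ≤ x ∧ x < u.length) ↔ (0 ≤ x ∧ x < v.length) := fun x => by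
    rw [← column_pos_iff, ← column_pos_iff, h]
  have hl : u.length = v.length := by
    have h1 := key u.length
    have h2 := key v.length
    omega
  refine List.ext_getElem hl fun k h1 h2 => PNat.coe_injective ?_
  rw [← column_getElem u k h1, ← column_getElem v k h2, h]

theorem column_reverse (u : Word) (x : ℤ) :
    column u.reverse x = column u (u.length - 1 - x) := by
  by_cases hx : 0 ≤ x ∧ x < u.length
  · obtain ⟨h0, h1⟩ := hx
    lift x to ℕ using h0
    have e : (u.length : ℤ) - 1 - x = ((u.length - 1 - x : ℕ) : ℤ) := by omega
    rw [e, column_getElem _ x (by simp; omega), column_getElem _ _ (by omega),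
      List.getElem_reverse]
  · have h1 := column_pos_iff u.reverse x
    have h2 := column_pos_iff u (u.length - 1 - x)
    rw [List.length_reverse] at h1
    have : ¬ (0 ≤ (u.length : ℤ) - 1 - x ∧ (u.length : ℤ) - 1 - x < u.length) := by omega
    rw [← h1] at hx
    rw [← h2] at this
    omega

theorem norm_eq_sum_column (w : Word) : norm w = ∑ y ∈ Finset.range w.length, column w y := by
  rw [norm, ← Fin.sum_univ_getElem, Finset.sum_range]
  simp only [List.getElem_map]
  refine Fintype.sum_equiv (finCongr (by simp)) _ _ fun i => ?_
  exact (column_getElem w i (by simpa using i.2)).symm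

/-- The word of length `L` whose columns are those of `g`, zeros being replaced by ones. -/
def ofColumn (L : ℕ) (g : ℤ → ℕ) : Word := List.ofFn fun k : Fin L => (g (k : ℕ)).toPNat'

@[simp] theorem length_ofColumn (L : ℕ) (g : ℤ → ℕ) : (ofColumn L g).length = L := by
  simp [ofColumn]

theorem column_ofColumn {L : ℕ} (g : ℤ → ℕ) {x : ℤ} (h0 : 0 ≤ x) (h1 : x < L) :
    column (ofColumn L g) x = max 1 (g x) := by
  lift x to ℕ using h0
  rw [column_getElem _ x (by simpa using h1)]
  simp only [ofColumn, List.getElem_ofFn, Nat.toPNat'_coe]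
  split_ifs <;> omega

/-! ### Level equivalence and shift equivalence. -/

/-- Two words are level equivalent if, for every `i ≥ 1`, the sets of positions whose letters are
at least `i` are translates of each other. -/
def LevelEquiv (u v : Word) : Prop :=
  ∀ i, 0 < i → ∃ t : ℤ, ∀ x, i ≤ column v (x + t) ↔ i ≤ column u x

theorem LevelEquiv.refl (u : Word) : LevelEquiv u u := fun _ _ => ⟨0, fun x => by simp⟩

theorem LevelEquiv.symm {u v : Word} (h : LevelEquiv u v) : LevelEquiv v u := fun i hi => by
  obtain ⟨t, ht⟩ := h i hi
  exact ⟨-t, fun x => by rw [← ht]; simp⟩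

theorem LevelEquiv.trans {u v w : Word} (h : LevelEquiv u v) (h' : LevelEquiv v w) :
    LevelEquiv u w := fun i hi => by
  obtain ⟨t, ht⟩ := h i hi
  obtain ⟨s, hs⟩ := h' i hi
  exact ⟨t + s, fun x => by rw [← ht, ← hs, add_assoc]⟩

theorem LevelEquiv.reverse {u v : Word} (h : LevelEquiv u v) :
    LevelEquiv u.reverse v.reverse := fun i hi => by
  obtain ⟨t, ht⟩ := h i hi
  -- The translation by `t`, conjugated with the reflections `x ↦ length - 1 - x` of both words.
  refine ⟨v.length - u.length - t, fun x => ?_⟩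
  rw [column_reverse, column_reverse, ← ht]
  ring_nf

theorem RigidShift.levelEquiv {u v : Word} (H : RigidShift u v) : LevelEquiv u v := by
  obtain ⟨h, k, h0, h1, h2⟩ := H
  intro i hi
  by_cases hih : i ≤ h
  · refine ⟨0, fun x => ?_⟩
    have e := h2 x
    have l := h1 (x - k)
    rw [sub_add_cancel] at l
    rw [add_zero]
    omega
  · refine ⟨k, fun x => ?_⟩
    have e := h2 (x + k)
    have l := h1 x
    rw [add_sub_cancel_right] at e
    omega

/-- Cut at `h` and move by the vector that carries level `h + 1` of `u` to that of `v`. The moved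
blocks find support because level `h + 1` of `v` lies inside level `h` of `v`, which is already
level `h` of `u`. -/
theorem LevelEquiv.exists_rigidShift {u v : Word} (H : LevelEquiv u v) {h : ℕ} (h0 : 0 < h)
    (hl : ∀ i ≤ h, ∀ x, i ≤ column v x ↔ i ≤ column u x) :
    ∃ u', RigidShift u u' ∧ ∀ i ≤ h + 1, ∀ x, i ≤ column v x ↔ i ≤ column u' x := by
  obtain ⟨t, ht⟩ := H (h + 1) (by omega)
  have key : ∀ i : ℤ, h < column u i → min (column u (i + t)) h = h := fun i hi => by
    have h1 := (ht i).2 hi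
    have h2 := (hl h le_rfl (i + t)).1 (by omega)
    omega
  -- `ofColumn` raises zeros to one and truncates at the length. Neither has an effect here: a cut
  -- at `h > 0` leaves every column nonempty, and moved blocks land on existing columns.
  have hcol : ∀ j, column (ofColumn u.length
      fun j => min (column u j) h + (column u (j - t) - h)) j =
        min (column u j) h + (column u (j - t) - h) := fun j => by
    by_cases hj : 0 ≤ j ∧ j < u.length
    · rw [column_ofColumn _ hj.1 hj.2]
      have := (column_pos_iff u j).2 hj
      omega
    · have h1 := column_pos_iff (ofColumn u.length
        fun j => min (column u j) h + (column u (j - t) - h)) j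
      rw [length_ofColumn] at h1
      have h2 := mt (column_pos_iff u j).1 hj
      have h3 := mt h1.1 hj
      have h4 := key (j - t)
      rw [sub_add_cancel] at h4
      omega
  refine ⟨_, ⟨h, t, h0, key, hcol⟩, fun i hi x => ?_⟩
  rw [hcol]
  have h4 := key (x - t)
  have h5 := ht (x - t)
  rw [sub_add_cancel] at h4 h5
  rcases Nat.lt_or_ge h i with hlt | hge
  · have : i = h + 1 := by omega
    subst this
    omega
  · rw [hl i hge]
    omega

theorem column_le_norm (u : Word) (x : ℤ) : column u x ≤ norm u := by
  by_cases hx : 0 ≤ x ∧ x < u.length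
  · obtain ⟨h0, h1⟩ := hx
    lift x to ℕ using h0
    rw [norm_eq_sum_column]
    exact Finset.single_le_sum (f := fun y : ℕ => column u y) (fun _ _ => Nat.zero_le _)
      (Finset.mem_range.2 (by omega))
  · have := mt (column_pos_iff u x).1 hx
    omega

theorem LevelEquiv.shiftEquiv {u v : Word} (H : LevelEquiv u v) (hl : u.length = v.length) :
    ShiftEquiv u v := by
  have key : ∀ h, 0 < h → ∃ u', ShiftEquiv u u' ∧ LevelEquiv u' v ∧
      ∀ i ≤ h, ∀ x, i ≤ column v x ↔ i ≤ column u' x := by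
    intro h h0
    induction h, h0 using Nat.le_induction with
    | base =>
      refine ⟨u, ShiftEquiv.equivalence.refl u, H, fun i hi x => ?_⟩
      have h1 := column_pos_iff u x
      have h2 := column_pos_iff v x
      rw [hl] at h1
      have h3 := h1.trans h2.symm
      omega
    | succ h h0 ih =>
      obtain ⟨w, h1, h2, h3⟩ := ih
      obtain ⟨w', h4, h5⟩ := h2.exists_rigidShift h0 h3
      exact ⟨w', h1.tail (Or.inl h4), h4.levelEquiv.symm.trans h2, h5⟩
  -- One more than any column of `v`, so that agreement up to level `N` also prevents `w` from
  -- rising above `v`.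
  obtain ⟨N, hN⟩ : ∃ N, N = norm v + 1 := ⟨_, rfl⟩
  obtain ⟨w, h1, h2, h3⟩ := key N (by omega)
  have : w = v := column_ext fun x => by
    have hv := column_le_norm v x
    refine le_antisymm ?_ ((h3 _ (by omega) x).1 le_rfl)
    by_contra! hc
    have := (h3 (column v x + 1) (by omega) x).2 hc
    omega
  exact this ▸ h1

/-- Reversal respects level equivalence, so all reversals in a chain can be collected into at most
one at its start. -/
theorem shiftEquiv_iff {u v : Word} (hl : u.length = v.length) :
    ShiftEquiv u v ↔ LevelEquiv u v ∨ LevelEquiv u.reverse v := by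
  constructor
  · clear hl
    intro H
    induction H with
    | refl => exact Or.inl (.refl u)
    | tail _ h ih =>
      rcases h with h | rfl
      · exact ih.imp (fun e => e.trans h.levelEquiv) (fun e => e.trans h.levelEquiv)
      · rcases ih with e | e
        · exact Or.inr e.reverse
        · exact Or.inl (by simpa using e.reverse)
  · rintro (h | h)
    · exact h.shiftEquiv hl
    · exact .head (Or.inr rfl) (h.shiftEquiv (by simpa using hl))

/-! ### Embedding sets and unions of shifted skylines. -/

theorem zero_notMem_Em (u w : Word) : 0 ∉ Em u w := by
  rintro ⟨s, v, t, -, h, -⟩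
  omega

theorem succ_mem_Em_iff {u : Word} (hu : u ≠ []) (w : Word) (s : ℕ) :
    s + 1 ∈ Em u w ↔ ∀ x, column u x ≤ column w (x + s) := by
  constructor
  · rintro ⟨a, v, t, rfl, hs, hf⟩ x
    obtain rfl : s = a.length := by omega
    by_cases hx : 0 ≤ x ∧ x < u.length
    · obtain ⟨h0, h1⟩ := hx
      lift x to ℕ using h0
      have hl := hf.length_eq
      have h1' : x < u.length := by omega
      have := (List.forall₂_iff_get.1 hf).2 x h1' (by omega)
      have e : (x : ℤ) + a.length = ((a.length + x : ℕ) : ℤ) := by push_cast; ring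
      rw [e, column_getElem u x h1', column_getElem _ _ (by simp; omega)]
      simp only [List.get_eq_getElem] at this
      rw [List.getElem_append_left (by simp; omega), List.getElem_append_right (by omega)]
      simpa using this
    · have := mt (column_pos_iff u x).1 hx
      omega
  · intro h
    have hpos := List.length_pos_of_ne_nil hu
    have hlen : s + u.length ≤ w.length := by
      -- The last letter of `u` is positive, so the position it is compared with lies inside `w`.
      have h1 := h (u.length - 1)
      have h2 := (column_pos_iff u (u.length - 1)).2 (by omega)
      have h3 := (column_pos_iff w (u.length - 1 + s)).1 (by omega)
      omega
    refine ⟨w.take s, (w.drop s).take u.length, (w.drop s).drop u.length, by simp, ?_, ?_⟩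
    · rw [List.length_take]; omega
    · refine List.forall₂_iff_get.2 ⟨by simp; omega, fun k h1 h2 => ?_⟩
      have h3 := h k
      have e : (k : ℤ) + s = ((s + k : ℕ) : ℤ) := by push_cast; ring
      rw [e, column_getElem u k h1, column_getElem w _ (by omega)] at h3
      simpa using h3

theorem le_length_of_mem_Em {u w : Word} {j : ℕ} (hj : j ∈ Em u w) : j ≤ w.length + 1 := by
  obtain ⟨s, v, t, rfl, rfl, -⟩ := hj
  simp only [List.length_append]; omega

/-- The cells above the bottom row of the skyline diagram of `u` moved `s` places to the right. -/
noncomputable def shiftCells (u : Word) (s : ℕ) : Finset (ℤ × ℕ) :=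
  (Finset.Ico (s : ℤ) (s + u.length) ×ˢ Finset.Icc 2 (norm u)).filter
    fun p => p.2 ≤ column u (p.1 - s)

theorem mem_shiftCells {u : Word} {s : ℕ} {p : ℤ × ℕ} :
    p ∈ shiftCells u s ↔ 2 ≤ p.2 ∧ p.2 ≤ column u (p.1 - s) := by
  simp only [shiftCells, Finset.mem_filter, Finset.mem_product, Finset.mem_Ico, Finset.mem_Icc]
  have h1 := column_le_norm u (p.1 - s)
  have h2 := column_pos_iff u (p.1 - s)
  constructor
  · exact fun h => ⟨h.1.2.1, h.2⟩
  · rintro ⟨h3, h4⟩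
    have := h2.1 (by omega)
    refine ⟨⟨?_, h3, h4.trans h1⟩, h4⟩
    omega

/-- The columns of the union of the skyline diagrams of `u` moved by the elements of `T`. -/
def hull (u : Word) (T : Finset ℕ) (y : ℤ) : ℕ := T.sup fun s => column u (y - s)

theorem mem_biUnion_shiftCells {u : Word} {T : Finset ℕ} {p : ℤ × ℕ} :
    p ∈ T.biUnion (shiftCells u) ↔ 2 ≤ p.2 ∧ p.2 ≤ hull u T p.1 := by
  simp only [Finset.mem_biUnion, mem_shiftCells, hull]
  constructor
  · rintro ⟨s, hs, h2, h⟩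
    exact ⟨h2, h.trans (Finset.le_sup (f := fun s : ℕ => column u (p.1 - s)) hs)⟩
  · rintro ⟨h2, h⟩
    rw [Finset.le_sup_iff (by simp; omega)] at h
    obtain ⟨s, hs, h⟩ := h
    exact ⟨s, hs, h2, h⟩

/-- The bottom row is full in every word and contributes `L`. Only cells at height at least two
depend on `u` and `T`, which is why `shiftCells` omits the first row. -/
theorem norm_hull {u : Word} {T : Finset ℕ} {L : ℕ} (hT : ∀ s ∈ T, s + u.length ≤ L) :
    norm (ofColumn L (hull u T)) = L + (T.biUnion (shiftCells u)).card := by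
  have hmaps : ∀ p ∈ T.biUnion (shiftCells u), p.1.toNat ∈ Finset.range L := by
    intro p hp
    obtain ⟨s, hs, h⟩ := Finset.mem_biUnion.1 hp
    have h1 := mem_shiftCells.1 h
    have h2 := (column_pos_iff u (p.1 - s)).1 (by omega)
    have h3 := hT s hs
    rw [Finset.mem_range]
    omega
  rw [Finset.card_eq_sum_card_fiberwise hmaps, norm_eq_sum_column, length_ofColumn]
  have : ∀ y ∈ Finset.range L, column (ofColumn L (hull u T)) y = 1 +
      ((T.biUnion (shiftCells u)).filter fun p => p.1.toNat = y).card := by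
    intro y hy
    have hy' := Finset.mem_range.1 hy
    rw [column_ofColumn _ (by omega) (by omega)]
    have e : ((T.biUnion (shiftCells u)).filter fun p => p.1.toNat = y) =
        (Finset.Icc 2 (hull u T y)).image fun i => ((y : ℤ), i) := by
      ext ⟨a, i⟩
      simp only [Finset.mem_filter, mem_biUnion_shiftCells, Finset.mem_image, Finset.mem_Icc,
        Prod.mk.injEq]
      constructor
      · rintro ⟨⟨h1, h2⟩, h3⟩
        -- `Int.toNat` sends all negative positions to `0`, so they have to be excluded from the
        -- fibre over `y`.
        have ha : 0 ≤ a := by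
          obtain ⟨s, hs, h⟩ := Finset.mem_biUnion.1 (mem_biUnion_shiftCells (p := (a, i)).2 ⟨h1, h2⟩)
          have h1 := mem_shiftCells.1 h
          have h2 := (column_pos_iff u (a - s)).1 (by simp only at h1; omega)
          omega
        obtain rfl : a = y := by omega
        exact ⟨i, ⟨h1, h2⟩, rfl, rfl⟩
      · rintro ⟨j, ⟨h1, h2⟩, rfl, rfl⟩
        exact ⟨⟨h1, h2⟩, by simp⟩
    rw [e, Finset.card_image_of_injective _ fun a b h => (Prod.mk.inj h).2, Nat.card_Icc]
    omega
  rw [Finset.sum_congr rfl this, Finset.sum_add_distrib]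
  simp

theorem succ_mem_Em_iff_hull {u w : Word} (hu : u ≠ []) (T : Finset ℕ) :
    (∀ s ∈ T, s + 1 ∈ Em u w) ↔ ∀ y, hull u T y ≤ column w y := by
  simp only [succ_mem_Em_iff hu, hull, Finset.sup_le_iff]
  constructor
  · intro h y s hs
    simpa using h s hs (y - s)
  · intro h s hs x
    simpa using h (x + s) s hs

theorem hull_le_ofColumn {u : Word} {T : Finset ℕ} {L : ℕ} (hT : ∀ s ∈ T, s + u.length ≤ L)
    (y : ℤ) : hull u T y ≤ column (ofColumn L (hull u T)) y := by
  by_cases hy : 0 ≤ y ∧ y < L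
  · rw [column_ofColumn _ hy.1 hy.2]
    exact le_max_right _ _
  · refine Finset.sup_le fun s hs => ?_
    have h1 := (column_pos_iff u (y - s)).1
    have h2 := hT s hs
    by_contra! hc
    have := h1 (by omega)
    omega

theorem max_one_hull_le {u w : Word} (hu : u ≠ []) {T : Finset ℕ}
    (h : ∀ s ∈ T, s + 1 ∈ Em u w) {y : ℕ} (hy : y < w.length) :
    max 1 (hull u T y) ≤ column w y := by
  have h1 := (succ_mem_Em_iff_hull hu T).1 h y
  have h2 := (column_pos_iff w y).2 (by omega)
  omega

theorem norm_hull_le {u w : Word} (hu : u ≠ []) {T : Finset ℕ}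
    (h : ∀ s ∈ T, s + 1 ∈ Em u w) : norm (ofColumn w.length (hull u T)) ≤ norm w := by
  rw [norm_eq_sum_column, norm_eq_sum_column w, length_ofColumn]
  refine Finset.sum_le_sum fun y hy => ?_
  have hy' := Finset.mem_range.1 hy
  rw [column_ofColumn _ (by omega) (by omega)]
  exact max_one_hull_le hu h hy'

/-! ### From super-strong Wilf equivalence to level equivalence. -/

/-- The bijection sends the lightest word embedding `u` at all places of `T` to a word of the same
length and norm embedding `v` there, which is at least as heavy as the lightest such word for `v`.
-/
theorem SSWilf.card_biUnion_le {u v : Word} (H : SSWilf u v) (hu : u ≠ []) (hv : v ≠ [])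
    (hl : u.length = v.length) (T : Finset ℕ) :
    (T.biUnion (shiftCells v)).card ≤ (T.biUnion (shiftCells u)).card := by
  obtain ⟨f, hf, hE⟩ := H
  have hT : ∀ s ∈ T, s + u.length ≤ T.sup id + u.length := fun s hs =>
    Nat.add_le_add_right (Finset.le_sup (f := id) hs) _
  have h1 : ∀ s ∈ T, s + 1 ∈ Em u (ofColumn (T.sup id + u.length) (hull u T)) :=
    (succ_mem_Em_iff_hull hu T).2 (hull_le_ofColumn hT)
  rw [hE] at h1
  have h2 := norm_hull_le hv h1
  rw [(hf _).1, (hf _).2, length_ofColumn, norm_hull hT, norm_hull (hl ▸ hT)] at h2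
  omega

/-- Inclusion-exclusion: the sizes of all unions determine the sizes of all Boolean combinations.
With `T` empty the set is a difference of two unions; adding `a` to `T` subtracts the points outside
the set of `a`. -/
theorem card_filter_forall_eq {ι α : Type*} [DecidableEq ι] [DecidableEq α]
    {A B : ι → Finset α}
    (h : ∀ T : Finset ι, (T.biUnion A).card = (T.biUnion B).card) (F T R : Finset ι)
    (hR : R ⊆ F) (hT : T ⊆ F) :
    ((F.biUnion A).filter fun p => (∀ s ∈ T, p ∈ A s) ∧ ∀ r ∈ R, p ∉ A r).card =
      ((F.biUnion B).filter fun p => (∀ s ∈ T, p ∈ B s) ∧ ∀ r ∈ R, p ∉ B r).card := by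
  induction T using Finset.induction_on generalizing R with
  | empty =>
    have e : ∀ C : ι → Finset α,
        ((F.biUnion C).filter fun p => (∀ s ∈ (∅ : Finset ι), p ∈ C s) ∧ ∀ r ∈ R, p ∉ C r).card =
          (F.biUnion C).card - (R.biUnion C).card := fun C => by
      rw [← Finset.card_sdiff_of_subset (Finset.biUnion_subset_biUnion_of_subset_left C hR)]
      congr 1
      ext p
      simp
    rw [e, e, h, h]
  | insert a T ha ih =>
    have split : ∀ C : ι → Finset α,
        ((F.biUnion C).filter fun p => (∀ s ∈ T, p ∈ C s) ∧ ∀ r ∈ R, p ∉ C r).card =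
          ((F.biUnion C).filter fun p => (∀ s ∈ insert a T, p ∈ C s) ∧ ∀ r ∈ R, p ∉ C r).card +
          ((F.biUnion C).filter
            fun p => (∀ s ∈ T, p ∈ C s) ∧ ∀ r ∈ insert a R, p ∉ C r).card := fun C => by
      rw [← Finset.card_filter_add_card_filter_not (p := fun p => p ∈ C a), Finset.filter_filter,
        Finset.filter_filter]
      congr 2 <;> ext p <;> simp only [Finset.mem_filter, Finset.forall_mem_insert] <;> tauto
    have h1 := ih R hR ((Finset.subset_insert a T).trans hT)
    have h2 := ih (insert a R) (Finset.insert_subset (hT (Finset.mem_insert_self a T)) hR)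
      ((Finset.subset_insert a T).trans hT)
    rw [split, split, h2] at h1
    exact Nat.add_right_cancel h1

/-- The set of positions of `u` that carry a letter `≥ k`, for `k ≥ 1`. -/
noncomputable def level (u : Word) (k : ℕ) : Finset ℤ :=
  (Finset.Ico (0 : ℤ) u.length).filter fun x => k ≤ column u x

theorem mem_level {u : Word} {k : ℕ} (hk : 0 < k) {x : ℤ} : x ∈ level u k ↔ k ≤ column u x := by
  have := column_pos_iff u x
  simp only [level, Finset.mem_filter, Finset.mem_Ico]
  omega

/-- By strong induction on `k`. For a suitable `T`, the common cells of the shifted skylines of `w`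
count the translates of level `k` of `u` that fit into the levels `i ≥ 2` of `w`. The total is the
same for `u` and `v`, and so is the share of `i < k` by induction. Hence a translate fits into some
level `i ≥ k` of `v`, thus into level `k`, and equal sizes make it all of that level. -/
theorem levelEquiv_of_card_biUnion {u v : Word}
    (hl : u.length = v.length) (hc : ∀ k, (level u k).card = (level v k).card)
    (h : ∀ T : Finset ℕ, (T.biUnion (shiftCells u)).card = (T.biUnion (shiftCells v)).card) :
    LevelEquiv u v := by
  intro k
  induction k using Nat.strong_induction_on with
  | _ k ih =>
  intro hk
  rcases Nat.lt_or_ge 1 k with hk1 | hk1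
  swap
  · obtain rfl : k = 1 := by omega
    refine ⟨0, fun x => ?_⟩
    have h1 := column_pos_iff u x
    have h2 := column_pos_iff v x
    rw [add_zero]
    rw [← hl] at h2
    exact h2.trans h1.symm
  rcases (level u k).eq_empty_or_nonempty with he | hne
  · have he' : level v k = ∅ := by rw [← Finset.card_eq_zero, ← hc, he, Finset.card_empty]
    refine ⟨0, fun x => ?_⟩
    rw [← mem_level hk, ← mem_level hk, he, he']
    simp
  -- The reflected level: `p - s` for `s ∈ T` runs through the translate of level `k` by `p -
  -- u.length`. Subtracting from the length keeps the shifts natural numbers.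
  obtain ⟨T, hT⟩ : ∃ T, T = (level u k).image fun x => ((u.length : ℤ) - x).toNat := ⟨_, rfl⟩
  have hTmem : ∀ x, k ≤ column u x → ((u.length : ℤ) - x).toNat ∈ T := fun x hx =>
    hT ▸ Finset.mem_image_of_mem _ ((mem_level hk).2 hx)
  obtain ⟨x₀, hx₀⟩ := hne
  rw [mem_level hk] at hx₀
  have hcommon := card_filter_forall_eq h T T ∅ (Finset.empty_subset _) subset_rfl
  simp only [Finset.notMem_empty, false_imp_iff, implies_true, and_true] at hcommon
  have hmem : ∀ (w : Word) (p : ℤ × ℕ), p ∈ ((T.biUnion (shiftCells w)).filter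
      fun p => ∀ s ∈ T, p ∈ shiftCells w s) ↔ 2 ≤ p.2 ∧ ∀ s ∈ T, p.2 ≤ column w (p.1 - s) := by
    intro w p
    simp only [Finset.mem_filter, Finset.mem_biUnion, mem_shiftCells]
    constructor
    · rintro ⟨⟨s, hs, h1, h2⟩, h3⟩
      exact ⟨h1, fun s hs => (h3 s hs).2⟩
    · rintro ⟨h1, h2⟩
      exact ⟨⟨_, hTmem x₀ hx₀, h1, h2 _ (hTmem x₀ hx₀)⟩, fun s hs => ⟨h1, h2 s hs⟩⟩
  obtain ⟨C, hC⟩ : ∃ C : Word → Finset (ℤ × ℕ), C = fun w => (T.biUnion (shiftCells w)).filter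
      fun p => ∀ s ∈ T, p ∈ shiftCells w s := ⟨_, rfl⟩
  replace hmem : ∀ w p, p ∈ C w ↔ 2 ≤ p.2 ∧ ∀ s ∈ T, p.2 ≤ column w (p.1 - s) := hC ▸ hmem
  replace hcommon : (C u).card = (C v).card := hC ▸ hcommon
  have hlow : ((C u).filter fun p => p.2 < k).card = ((C v).filter fun p => p.2 < k).card := by
    have : ∀ i, ∃ t : ℤ, 0 < i → i < k → ∀ x, i ≤ column v (x + t) ↔ i ≤ column u x := fun i => by
      by_cases hi : i < k ∧ 0 < i
      · obtain ⟨t, ht⟩ := ih i hi.1 hi.2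
        exact ⟨t, fun _ _ => ht⟩
      · exact ⟨0, fun h1 h2 => absurd ⟨h2, h1⟩ hi⟩
    choose t ht using this
    have key : ∀ a i, (a, i) ∈ (C u).filter (fun p => p.2 < k) ↔
        (a + t i, i) ∈ (C v).filter (fun p => p.2 < k) := by
      intro a i
      simp only [Finset.mem_filter, hmem]
      refine and_congr_left fun hi => and_congr_right fun h2 => forall₂_congr fun s _ => ?_
      rw [← ht i (by omega) hi, show a + t i - s = a - s + t i by ring]
    refine Finset.card_nbij' (fun p => (p.1 + t p.2, p.2)) (fun p => (p.1 - t p.2, p.2))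
      (fun p hp => (key _ _).1 hp) (fun p hp => (key _ _).2 (by simpa using hp))
      (fun p _ => by simp) (fun p _ => by simp)
  -- The witness is the zero translate: level `k` fits into itself.
  have hhigh : 0 < ((C u).filter fun p => ¬ p.2 < k).card := by
    refine Finset.card_pos.2 ⟨((u.length : ℤ), k), ?_⟩
    simp only [Finset.mem_filter, hmem, lt_irrefl, not_false_eq_true, and_true]
    refine ⟨hk1, fun s hs => ?_⟩
    rw [hT] at hs
    obtain ⟨x, hx, rfl⟩ := Finset.mem_image.1 hs
    rw [mem_level hk] at hx
    have := (column_pos_iff u x).1 (by omega)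
    rwa [show (u.length : ℤ) - (((u.length : ℤ) - x).toNat : ℤ) = x by omega]
  have hv : 0 < ((C v).filter fun p => ¬ p.2 < k).card := by
    have h1 := Finset.card_filter_add_card_filter_not (s := C u) (fun p => p.2 < k)
    have h2 := Finset.card_filter_add_card_filter_not (s := C v) (fun p => p.2 < k)
    omega
  obtain ⟨⟨y, i⟩, hp⟩ := Finset.card_pos.1 hv
  simp only [Finset.mem_filter, hmem, not_lt] at hp
  obtain ⟨⟨-, hp⟩, hi⟩ := hp
  have hsub : (level u k).map (addRightEmbedding (y - u.length)) ⊆ level v k := by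
    intro z hz
    obtain ⟨x, hx, rfl⟩ := Finset.mem_map.1 hz
    rw [mem_level hk] at hx ⊢
    have h1 := hp _ (hTmem x hx)
    have h2 := (column_pos_iff u x).1 (by omega)
    rw [show y - (((u.length : ℤ) - x).toNat : ℤ) = x + (y - u.length) by omega] at h1
    exact hi.trans h1
  have heq := Finset.eq_of_subset_of_card_le hsub (by rw [Finset.card_map, hc])
  refine ⟨y - u.length, fun x => ?_⟩
  rw [← mem_level hk, ← mem_level hk, ← heq]
  simp

theorem SSWilf.levelEquiv {u v : Word} (H : SSWilf u v) (hu : u ≠ [])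
    (hl : u.length = v.length) (hc : ∀ k, (level u k).card = (level v k).card) :
    LevelEquiv u v := by
  have hv : v ≠ [] := by
    rintro rfl
    exact hu (List.length_eq_zero_iff.1 (by simpa using hl))
  exact levelEquiv_of_card_biUnion hl hc fun T => le_antisymm
    ((SSWilf.equivalence.symm H).card_biUnion_le hv hu hl.symm T) (H.card_biUnion_le hu hv hl T)

/-! ### From level equivalence to super-strong Wilf equivalence. -/

/-- Row `i` of one union is a translate of row `i` of the other, since the same vector moves every
copy. -/
theorem LevelEquiv.card_biUnion_eq {u v : Word} (H : LevelEquiv u v) (T : Finset ℕ) :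
    (T.biUnion (shiftCells u)).card = (T.biUnion (shiftCells v)).card := by
  have : ∀ i, ∃ t : ℤ, 0 < i → ∀ x, i ≤ column v (x + t) ↔ i ≤ column u x := fun i => by
    rcases Nat.eq_zero_or_pos i with rfl | hi
    · exact ⟨0, fun h => absurd h (lt_irrefl 0)⟩
    · obtain ⟨t, ht⟩ := H i hi
      exact ⟨t, fun _ => ht⟩
  choose t ht using this
  have key : ∀ a i, (a, i) ∈ T.biUnion (shiftCells u) ↔
      (a + t i, i) ∈ T.biUnion (shiftCells v) := by
    intro a i
    simp only [Finset.mem_biUnion, mem_shiftCells]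
    refine exists_congr fun s => and_congr_right fun _ => and_congr_right fun h2 => ?_
    rw [← ht i (by omega), show a + t i - s = a - s + t i by ring]
  exact Finset.card_nbij' (fun p => (p.1 + t p.2, p.2)) (fun p => (p.1 - t p.2, p.2))
    (fun p hp => (key _ _).1 hp) (fun p hp => (key _ _).2 (by simpa using hp))
    (fun p _ => by simp) (fun p _ => by simp)

theorem finite_setOf_norm_eq (N : ℕ) : {w : Word | norm w = N}.Finite := by
  -- Words of norm `N` are compositions of `N`.
  have : Function.Injective fun w : {w : Word | norm w = N} =>
      (⟨w.1.map (fun a : ℕ+ => (a : ℕ)), fun {i} hi => by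
        obtain ⟨a, -, rfl⟩ := List.mem_map.1 hi
        exact a.pos, w.2⟩ : Composition N) := fun a b h => by
    have := congrArg Composition.blocks h
    exact Subtype.ext (List.map_injective_iff.2 PNat.coe_injective this)
  have := Finite.of_injective _ this
  exact Set.toFinite _

/-- The words of length `L` and norm `N` whose embedding index set for `u` contains `T`. -/
def wordsWith (u : Word) (L N : ℕ) (T : Finset ℕ) : Set Word :=
  {w | w.length = L ∧ norm w = N ∧ ∀ s ∈ T, s + 1 ∈ Em u w}

/-- Keep the excess of a word over the hull of `u` and put it on top of the hull of `v`. This is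
injective, and it preserves the norm because the two hulls are equally heavy. -/
theorem LevelEquiv.ncard_wordsWith_le {u v : Word} (H : LevelEquiv u v) (hu : u ≠ [])
    (hv : v ≠ []) (hl : u.length = v.length) (L N : ℕ) (T : Finset ℕ) :
    (wordsWith u L N T).ncard ≤ (wordsWith v L N T).ncard := by
  have hfin : (wordsWith v L N T).Finite := (finite_setOf_norm_eq N).subset fun w hw => hw.2.1
  rcases (wordsWith u L N T).eq_empty_or_nonempty with he | ⟨w₀, h1, -, h3⟩
  · simp [he]
  have hT : ∀ s ∈ T, s + u.length ≤ L := by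
    intro s hs
    have h4 := (succ_mem_Em_iff hu w₀ s).1 (h3 s hs) (u.length - 1)
    have h5 := List.length_pos_of_ne_nil hu
    have h6 := (column_pos_iff u (u.length - 1)).2 (by omega)
    have h7 := (column_pos_iff w₀ (u.length - 1 + s)).1 (by omega)
    omega
  obtain ⟨g, hg⟩ : ∃ g : Word → Word, g = fun w => ofColumn L fun y =>
    column w y - max 1 (hull u T y) + max 1 (hull v T y) := ⟨_, rfl⟩
  have hcol : ∀ w (y : ℕ), y < L → column (g w) y =
      column w y - max 1 (hull u T y) + max 1 (hull v T y) := fun w y hy => by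
    rw [hg, column_ofColumn _ (by omega) (by omega)]
    omega
  have hlen : ∀ w, (g w).length = L := fun w => by rw [hg, length_ofColumn]
  have hle : ∀ w ∈ wordsWith u L N T, ∀ y : ℕ, y < L → max 1 (hull u T y) ≤ column w y :=
    fun w hw y hy => max_one_hull_le hu hw.2.2 (hw.1.symm ▸ hy)
  have hsum : ∑ y ∈ Finset.range L, max 1 (hull u T y) =
      ∑ y ∈ Finset.range L, max 1 (hull v T y) := by
    have e : ∀ w : Word, norm (ofColumn L (hull w T)) =
        ∑ y ∈ Finset.range L, max 1 (hull w T y) := fun w => by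
      rw [norm_eq_sum_column, length_ofColumn]
      refine Finset.sum_congr rfl fun y hy => ?_
      have := Finset.mem_range.1 hy
      exact column_ofColumn _ (by omega) (by omega)
    rw [← e, ← e, norm_hull hT, norm_hull (hl ▸ hT), H.card_biUnion_eq]
  refine Set.ncard_le_ncard_of_injOn g (fun w hw => ⟨hlen w, ?_, ?_⟩) (fun w hw w' hw' h => ?_) hfin
  · have e : norm (g w) + ∑ y ∈ Finset.range L, max 1 (hull u T y) =
        norm w + ∑ y ∈ Finset.range L, max 1 (hull v T y) := by
      rw [norm_eq_sum_column, norm_eq_sum_column w, hlen, hw.1, ← Finset.sum_add_distrib,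
        ← Finset.sum_add_distrib]
      refine Finset.sum_congr rfl fun y hy => ?_
      have hy' := Finset.mem_range.1 hy
      have := hle w hw y hy'
      rw [hcol w y hy']
      omega
    rw [hsum] at e
    exact (Nat.add_right_cancel e).trans hw.2.1
  · refine (succ_mem_Em_iff_hull hv T).2 fun y => ?_
    by_cases hy : 0 ≤ y ∧ y < L
    · obtain ⟨h0, h1⟩ := hy
      lift y to ℕ using h0
      rw [hcol w y (by omega)]
      omega
    · refine Finset.sup_le fun s hs => ?_
      have h1 := (column_pos_iff v (y - s)).1
      have h2 := hT s hs
      by_contra! hc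
      have := h1 (by omega)
      omega
  · refine column_ext fun y => ?_
    by_cases hy : 0 ≤ y ∧ y < L
    · obtain ⟨h0, h1⟩ := hy
      lift y to ℕ using h0
      have h2 := hle w hw y (by omega)
      have h3 := hle w' hw' y (by omega)
      have h4 := hcol w y (by omega)
      have h5 := hcol w' y (by omega)
      rw [h] at h4
      omega
    · have h1 := mt (column_pos_iff w y).1 (by rwa [hw.1])
      have h2 := mt (column_pos_iff w' y).1 (by rwa [hw'.1])
      omega

theorem LevelEquiv.ncard_wordsWith_eq {u v : Word} (H : LevelEquiv u v) (hu : u ≠ [])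
    (hv : v ≠ []) (hl : u.length = v.length) (L N : ℕ) (T : Finset ℕ) :
    (wordsWith u L N T).ncard = (wordsWith v L N T).ncard :=
  le_antisymm (H.ncard_wordsWith_le hu hv hl L N T) (H.symm.ncard_wordsWith_le hv hu hl.symm L N T)

/-- Inclusion-exclusion on the forbidden set `R`: the sets avoiding `a` are all sets minus those
containing `a`, and the latter condition moves into `T`. -/
theorem card_filter_subset_disjoint_eq {ι α : Type*} [DecidableEq α] (X : Finset ι)
    {g g' : ι → Finset α}
    (h : ∀ T, (X.filter fun x => T ⊆ g x).card = (X.filter fun x => T ⊆ g' x).card)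
    (R T : Finset α) : (X.filter fun x => T ⊆ g x ∧ ∀ r ∈ R, r ∉ g x).card =
      (X.filter fun x => T ⊆ g' x ∧ ∀ r ∈ R, r ∉ g' x).card := by
  induction R using Finset.induction_on generalizing T with
  | empty => simpa using h T
  | insert a R ha ih =>
    have split : ∀ k : ι → Finset α,
        (X.filter fun x => T ⊆ k x ∧ ∀ r ∈ R, r ∉ k x).card =
          (X.filter fun x => insert a T ⊆ k x ∧ ∀ r ∈ R, r ∉ k x).card +
          (X.filter fun x => T ⊆ k x ∧ ∀ r ∈ insert a R, r ∉ k x).card := fun k => by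
      rw [← Finset.card_filter_add_card_filter_not (p := fun x => a ∈ k x), Finset.filter_filter,
        Finset.filter_filter]
      congr 2 <;> ext p <;>
        simp only [Finset.mem_filter, Finset.forall_mem_insert, Finset.insert_subset_iff] <;> tauto
    have h1 := ih T
    rw [split, split, ih (insert a T)] at h1
    exact Nat.add_left_cancel h1

/-- If, for each `T`, as many members of a finite family of finite sets contain `T` as of
another one, then each set occurs equally often in both. -/
theorem card_fiber_eq_of_card_superset_eq {ι α : Type*} [DecidableEq α] (X : Finset ι)
    {g g' : ι → Finset α} (G : Finset α) (hg : ∀ x ∈ X, g x ⊆ G) (hg' : ∀ x ∈ X, g' x ⊆ G)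
    (h : ∀ T, (X.filter fun x => T ⊆ g x).card = (X.filter fun x => T ⊆ g' x).card)
    (T : Finset α) : (X.filter fun x => g x = T).card = (X.filter fun x => g' x = T).card := by
  have e : ∀ k : ι → Finset α, (∀ x ∈ X, k x ⊆ G) → (X.filter fun x => k x = T) =
      X.filter fun x => T ⊆ k x ∧ ∀ r ∈ G \ T, r ∉ k x := fun k hk => by
    refine Finset.filter_congr fun x hx => ⟨?_, fun ⟨h1, h2⟩ => ?_⟩
    · rintro rfl
      exact ⟨subset_rfl, fun r hr => (Finset.mem_sdiff.1 hr).2⟩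
    · refine Finset.Subset.antisymm (fun r hr => ?_) h1
      by_contra hc
      exact h2 r (Finset.mem_sdiff.2 ⟨hk x hx hr, hc⟩) hr
  rw [e g hg, e g' hg', card_filter_subset_disjoint_eq X h]

open Classical in
/-- The embedding index set, each index decreased by one, as a finite set. -/
noncomputable def embFinset (u w : Word) : Finset ℕ :=
  (Finset.range (w.length + 1)).filter fun s => s + 1 ∈ Em u w

theorem mem_embFinset {u w : Word} {s : ℕ} : s ∈ embFinset u w ↔ s + 1 ∈ Em u w := by
  simp only [embFinset, Finset.mem_filter, Finset.mem_range, and_iff_right_iff_imp]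
  intro h
  exact le_length_of_mem_Em h

theorem embFinset_subset (u w : Word) : embFinset u w ⊆ Finset.range (w.length + 1) :=
  fun _ hs => Finset.mem_range.2 (le_length_of_mem_Em (mem_embFinset.1 hs))

/-- For each length, norm and embedding set the two fibres are finite and equally large, so
bijections between them glue to one of all words. -/
theorem LevelEquiv.ssWilf {u v : Word} (H : LevelEquiv u v) (hu : u ≠ [])
    (hl : u.length = v.length) : SSWilf u v := by
  have hv : v ≠ [] := by
    rintro rfl
    exact hu (List.length_eq_zero_iff.1 (by simpa using hl))
  obtain ⟨F, hF⟩ : ∃ F : Word → Word → ℕ × ℕ × Finset ℕ,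
    F = fun u w => (w.length, norm w, embFinset u w) := ⟨_, rfl⟩
  have key : ∀ c, Nonempty ({w // F u w = c} ≃ {w // F v w = c}) := by
    rintro ⟨L, N, T⟩
    have hfin : {w : Word | w.length = L ∧ norm w = N}.Finite :=
      (finite_setOf_norm_eq N).subset fun w hw => hw.2
    have hX : ∀ w, w ∈ hfin.toFinset ↔ w.length = L ∧ norm w = N := fun w => by simp
    have hsub : ∀ u : Word, ∀ w ∈ hfin.toFinset, embFinset u w ⊆ Finset.range (L + 1) :=
      fun u w hw => by
        rw [← ((hX w).1 hw).1]
        exact embFinset_subset u w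
    have hcount : ∀ T, (hfin.toFinset.filter fun w => T ⊆ embFinset u w).card =
        (hfin.toFinset.filter fun w => T ⊆ embFinset v w).card := fun T => by
      have e : ∀ u : Word, (hfin.toFinset.filter fun w => T ⊆ embFinset u w).card =
          (wordsWith u L N T).ncard := fun u => by
        rw [← Set.ncard_coe_finset]
        congr 1
        ext w
        simp [wordsWith, Finset.subset_iff, mem_embFinset, and_assoc]
      rw [e, e, H.ncard_wordsWith_eq hu hv hl]
    have hfib := card_fiber_eq_of_card_superset_eq _ _ (hsub u) (hsub v) hcount T
    have e : ∀ u : Word, Nonempty ({w // F u w = (L, N, T)} ≃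
        {w // w ∈ hfin.toFinset.filter fun w => embFinset u w = T}) := fun u =>
      ⟨Equiv.subtypeEquivRight fun w => by simp [hF, and_assoc]⟩
    obtain ⟨e1⟩ := e u
    obtain ⟨e2⟩ := e v
    exact ⟨e1.trans ((Finset.equivOfCardEq hfib).trans e2.symm)⟩
  have e c := (key c).some
  have hmap : ∀ w, F v (Equiv.ofFiberEquiv e w) = F u w := Equiv.ofFiberEquiv_map e
  generalize Equiv.ofFiberEquiv e = f at hmap
  subst hF
  simp only [Prod.mk.injEq] at hmap
  refine ⟨f, fun w => ⟨(hmap w).1, (hmap w).2.1⟩, fun w => ?_⟩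
  ext j
  rcases j with _ | s
  · simp [zero_notMem_Em]
  · rw [← mem_embFinset, ← mem_embFinset, (hmap w).2.2]

/-! ### Permutations as words. -/

theorem IsPermutation.length_eq {n : ℕ} {u : Word} (hu : IsPermutation n u) : u.length = n := by
  have e : u.toFinset.image (fun a : ℕ+ => (a : ℕ)) = Finset.Icc 1 n := by
    ext i
    simp only [Finset.mem_image, List.mem_toFinset, Finset.mem_Icc, hu.2]
    constructor
    · rintro ⟨a, ha, rfl⟩
      exact ⟨a.pos, ha⟩
    · rintro ⟨h1, h2⟩
      exact ⟨⟨i, h1⟩, h2, rfl⟩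
  rw [← List.toFinset_card_of_nodup hu.1,
    ← Finset.card_image_of_injective _ PNat.coe_injective, e, Nat.card_Icc, Nat.add_sub_cancel]

theorem IsPermutation.reverse {n : ℕ} {u : Word} (hu : IsPermutation n u) :
    IsPermutation n u.reverse :=
  ⟨List.nodup_reverse.2 hu.1, fun a => by rw [List.mem_reverse, hu.2]⟩

theorem IsPermutation.ne_nil {n : ℕ} {u : Word} (hu : IsPermutation n u) (hn : 0 < n) :
    u ≠ [] := by
  rintro rfl
  have := hu.length_eq
  simp at this
  omega

theorem IsPermutation.column_le {n : ℕ} {u : Word} (hu : IsPermutation n u) (x : ℤ) :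
    column u x ≤ n := by
  by_cases hx : 0 ≤ x ∧ x < u.length
  · obtain ⟨h0, h1⟩ := hx
    lift x to ℕ using h0
    rw [column_getElem u x (by omega)]
    exact (hu.2 _).1 (List.getElem_mem _)
  · have := mt (column_pos_iff u x).1 hx
    omega

theorem IsPermutation.exists_column_eq_iff {n : ℕ} {u : Word} (hu : IsPermutation n u) {i : ℕ}
    (h1 : 1 ≤ i) (h2 : i ≤ n) : ∃ p, ∀ x, column u x = i ↔ x = p := by
  obtain ⟨k, hk, e⟩ := List.mem_iff_getElem.1 ((hu.2 ⟨i, h1⟩).2 h2)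
  have hki : column u k = i := by rw [column_getElem u k hk, e]; rfl
  refine ⟨k, fun x => ⟨fun hx => ?_, fun hx => hx ▸ hki⟩⟩
  obtain ⟨h3, h4⟩ := (column_pos_iff u x).1 (by omega)
  lift x to ℕ using h3
  have h5 : x < u.length := by omega
  rw [column_getElem u x h5, ← hki, column_getElem u k hk] at hx
  have := (hu.1.getElem_inj_iff).1 (PNat.coe_injective hx)
  omega

theorem IsPermutation.card_level {n : ℕ} {u : Word} (hu : IsPermutation n u) {k : ℕ}
    (hk : 0 < k) : (level u k).card = (Finset.Icc k n).card := by
  refine Finset.card_nbij (column u) (fun x hx => ?_) (fun x hx y hy h => ?_) (fun i hi => ?_)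
  · rw [Finset.mem_coe, mem_level hk] at hx
    exact Finset.mem_coe.2 (Finset.mem_Icc.2 ⟨hx, hu.column_le x⟩)
  · rw [Finset.mem_coe, mem_level hk] at hx
    obtain ⟨p, hp⟩ := hu.exists_column_eq_iff (i := column u x) (by omega) (hu.column_le x)
    rw [(hp x).1 rfl, (hp y).1 h.symm]
  · obtain ⟨h1, h2⟩ := Finset.mem_Icc.1 (Finset.mem_coe.1 hi)
    obtain ⟨p, hp⟩ := hu.exists_column_eq_iff (i := i) (by omega) h2
    have := (hp p).2 rfl
    exact ⟨p, Finset.mem_coe.2 ((mem_level hk).2 (by omega)), this⟩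

theorem IsPermutation.ssWilf_iff {n : ℕ} (hn : 0 < n) {u v : Word} (hu : IsPermutation n u)
    (hv : IsPermutation n v) : SSWilf u v ↔ LevelEquiv u v := by
  have hl : u.length = v.length := hu.length_eq.trans hv.length_eq.symm
  refine ⟨fun H => H.levelEquiv (hu.ne_nil hn) hl fun k => ?_,
    fun H => H.ssWilf (hu.ne_nil hn) hl⟩
  rcases Nat.eq_zero_or_pos k with rfl | hk
  · simp [level, hl]
  · rw [hu.card_level hk, hv.card_level hk]

instance finite_permWord (n : ℕ) : Finite (PermWord n) := by
  rcases isEmpty_or_nonempty (PermWord n) with h | ⟨⟨u, hu⟩⟩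
  · infer_instance
  · refine ((finite_setOf_norm_eq (norm u)).subset fun v (hv : IsPermutation n v) => ?_).to_subtype
    refine (((List.perm_ext_iff_of_nodup hv.1 hu.1).2 fun a => ?_).map _).sum_eq
    rw [hv.2, hu.2]

/-! ### Permutations that are level equivalent to their reversal. -/

/-- The `i`-th level of `u` is an interval of `n + 1 - i` positions. -/
def IntervalLevel (n : ℕ) (u : Word) (i : ℕ) : Prop :=
  ∃ c : ℤ, ∀ x, i ≤ column u x ↔ c ≤ x ∧ x ≤ c + (n - i)

/-- All levels are intervals. -/
def Straight (n : ℕ) (u : Word) : Prop :=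
  (∀ x, column u x ≤ n) ∧ ∀ i, 1 ≤ i → i ≤ n → IntervalLevel n u i

/-- All levels are intervals, except that the two largest letters enclose one position. -/
def Gapped (n : ℕ) (u : Word) : Prop :=
  (∀ x, column u x ≤ n) ∧ (∀ i, 1 ≤ i → i ≤ n → i ≠ n - 1 → IntervalLevel n u i) ∧
    ∃ c : ℤ, ∀ x, n - 1 ≤ column u x ↔ x = c ∨ x = c + 2

theorem IntervalLevel.exists_shift {n : ℕ} {u v : Word} {i : ℕ} (hu : IntervalLevel n u i)
    (hv : IntervalLevel n v i) : ∃ t : ℤ, ∀ x, i ≤ column v (x + t) ↔ i ≤ column u x := by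
  obtain ⟨c, hc⟩ := hu
  obtain ⟨d, hd⟩ := hv
  refine ⟨d - c, fun x => ?_⟩
  rw [hc, hd]
  omega

theorem IntervalLevel.reverse {n : ℕ} {u : Word} {i : ℕ} (hu : IntervalLevel n u i) :
    IntervalLevel n u.reverse i := by
  obtain ⟨c, hc⟩ := hu
  refine ⟨u.length - 1 - c - (n - i), fun x => ?_⟩
  rw [column_reverse, hc]
  omega

theorem Straight.reverse {n : ℕ} {u : Word} (hu : Straight n u) : Straight n u.reverse :=
  ⟨fun x => column_reverse u x ▸ hu.1 _, fun i h1 h2 => (hu.2 i h1 h2).reverse⟩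

theorem Gapped.reverse {n : ℕ} {u : Word} (hu : Gapped n u) : Gapped n u.reverse := by
  refine ⟨fun x => column_reverse u x ▸ hu.1 _, fun i h1 h2 h3 => (hu.2.1 i h1 h2 h3).reverse, ?_⟩
  obtain ⟨c, hc⟩ := hu.2.2
  refine ⟨u.length - 1 - c - 2, fun x => ?_⟩
  rw [column_reverse, hc]
  omega

theorem exists_shift_of_column_le {n : ℕ} {u v : Word} (hu : ∀ x, column u x ≤ n)
    (hv : ∀ x, column v x ≤ n) {i : ℕ} (hi : n < i) :
    ∃ t : ℤ, ∀ x, i ≤ column v (x + t) ↔ i ≤ column u x :=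
  ⟨0, fun x => by have := hu x; have := hv (x + 0); omega⟩

theorem Straight.levelEquiv {n : ℕ} {u v : Word} (hu : Straight n u) (hv : Straight n v) :
    LevelEquiv u v := fun i hi => by
  rcases Nat.lt_or_ge n i with h | h
  · exact exists_shift_of_column_le hu.1 hv.1 h
  · exact (hu.2 i hi h).exists_shift (hv.2 i hi h)

theorem Gapped.levelEquiv {n : ℕ} {u v : Word} (hu : Gapped n u) (hv : Gapped n v) :
    LevelEquiv u v := fun i hi => by
  rcases Nat.lt_or_ge n i with h | h
  · exact exists_shift_of_column_le hu.1 hv.1 h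
  · by_cases hin : i = n - 1
    · subst hin
      obtain ⟨c, hc⟩ := hu.2.2
      obtain ⟨d, hd⟩ := hv.2.2
      refine ⟨d - c, fun x => ?_⟩
      rw [hc, hd]
      omega
    · exact (hu.2.1 i hi h hin).exists_shift (hv.2.1 i hi h hin)

/-- Level `n - 1` consists of two adjacent positions in one case and of two positions at distance
two in the other. -/
theorem Straight.not_levelEquiv {n : ℕ} (hn : 2 ≤ n) {u v : Word} (hu : Straight n u)
    (hv : Gapped n v) : ¬ LevelEquiv u v := by
  intro H
  obtain ⟨t, ht⟩ := H (n - 1) (by omega)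
  obtain ⟨c, hc⟩ := hu.2 (n - 1) (by omega) (by omega)
  obtain ⟨d, hd⟩ := hv.2.2
  have h1 := (hc c).2 (by omega)
  have h2 := (hc (c + 1)).2 (by omega)
  rw [← ht, hd] at h1 h2
  omega

theorem exists_reflection_of_levelEquiv_reverse {u : Word} (H : LevelEquiv u u.reverse) {i : ℕ}
    (hi : 0 < i) : ∃ t : ℤ, ∀ x, i ≤ column u (t - x) ↔ i ≤ column u x := by
  obtain ⟨t, ht⟩ := H i hi
  refine ⟨u.length - 1 - t, fun x => ?_⟩
  rw [← ht, column_reverse]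
  ring_nf

/-- Passing from level `i` to `i + 1` deletes one position `a` from an interval, and the result must
have a reflection symmetry. So `a` is an endpoint or the midpoint. The midpoint is refuted one level
higher: no deletion of a second position `b` leaves a symmetric set, as long as the interval has at
least four positions. -/
theorem IsPermutation.intervalLevel {n : ℕ} {u : Word} (hu : IsPermutation n u)
    (H : LevelEquiv u u.reverse) {i : ℕ} (h1 : 1 ≤ i) (hi : i + 2 ≤ n) : IntervalLevel n u i := by
  induction i, h1 using Nat.le_induction with
  | base =>
    refine ⟨0, fun x => ?_⟩
    have := column_pos_iff u x
    rw [hu.length_eq] at this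
    omega
  | succ i h1 ih =>
    obtain ⟨c, hc⟩ := ih (by omega)
    obtain ⟨a, ha⟩ := hu.exists_column_eq_iff h1 (by omega)
    obtain ⟨b, hb⟩ := hu.exists_column_eq_iff (i := i + 1) (by omega) (by omega)
    obtain ⟨t, ht⟩ := exists_reflection_of_levelEquiv_reverse H (i := i + 1) (by omega)
    obtain ⟨t', ht'⟩ := exists_reflection_of_levelEquiv_reverse H (i := i + 2) (by omega)
    obtain ⟨d, hd⟩ : ∃ d : ℤ, d = c + (n - i) := ⟨_, rfl⟩
    rw [← hd] at hc
    have hB : ∀ x, i + 1 ≤ column u x ↔ (c ≤ x ∧ x ≤ d) ∧ x ≠ a := fun x => by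
      have := hc x
      have := ha x
      omega
    have hC : ∀ x, i + 2 ≤ column u x ↔ ((c ≤ x ∧ x ≤ d) ∧ x ≠ a) ∧ x ≠ b := fun x => by
      have := hB x
      have := hb x
      omega
    simp only [hB] at ht
    simp only [hC] at ht'
    have haI := (hc a).1 (by have := ha a; omega)
    have hbB := (hB b).1 (by have := hb b; omega)
    by_cases hac : a = c
    · refine ⟨c + 1, fun x => ?_⟩
      rw [hB]
      push_cast
      omega
    by_cases had : a = d
    · refine ⟨c, fun x => ?_⟩
      rw [hB]
      push_cast
      omega
    exfalso
    -- Both endpoints survive, so the reflection must exchange them.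
    have e : t = c + d := by
      have := ht c
      have := ht d
      omega
    have e' : 2 * a = c + d := by
      have := ht a
      omega
    -- Deleting an endpoint moves the centre by one half, and the hole at `a` is then reflected to a
    -- neighbour of `a` that is present.
    by_cases hbc : b = c
    · have : t' = c + 1 + d := by
        have := ht' (c + 1)
        have := ht' d
        omega
      have := ht' a
      omega
    by_cases hbd : b = d
    · have : t' = c + d - 1 := by
        have := ht' c
        have := ht' (d - 1)
        omega
      have := ht' a
      omega
    -- With both endpoints present the centre is still `a`, so the second hole `b` has no mirror
    -- image.
    have : t' = c + d := by
      have := ht' c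
      have := ht' d
      omega
    have := ht' b
    omega

/-- Level `n - 2` is an interval of three positions. The only freedom that matters is whether the
letter `n - 2` sits in its middle or at an end. -/
theorem IsPermutation.straight_or_gapped {n : ℕ} (hn : 3 ≤ n) {u : Word} (hu : IsPermutation n u)
    (H : LevelEquiv u u.reverse) : Straight n u ∨ Gapped n u := by
  obtain ⟨c, hc⟩ := hu.intervalLevel H (i := n - 2) (by omega) (by omega)
  obtain ⟨a, ha⟩ := hu.exists_column_eq_iff (i := n - 2) (by omega) (by omega)
  obtain ⟨b, hb⟩ := hu.exists_column_eq_iff (i := n) (by omega) le_rfl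
  have htop : IntervalLevel n u n := ⟨b, fun x => by
    have := hu.column_le x
    have := hb x
    omega⟩
  have hlow : ∀ i, 1 ≤ i → i ≤ n → i ≠ n - 1 → IntervalLevel n u i := fun i h1 h2 h3 => by
    rcases h2.eq_or_lt with rfl | h2
    · exact htop
    · exact hu.intervalLevel H h1 (by omega)
  have hB : ∀ x, n - 1 ≤ column u x ↔ (c ≤ x ∧ x ≤ c + 2) ∧ x ≠ a := fun x => by
    have := hc x
    have := ha x
    omega
  have haI := (hc a).1 (by have := ha a; omega)
  by_cases hac : a = c + 1
  · refine Or.inr ⟨hu.column_le, hlow, c, fun x => ?_⟩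
    rw [hB]
    omega
  · refine Or.inl ⟨hu.column_le, fun i h1 h2 => ?_⟩
    by_cases h3 : i = n - 1
    · subst h3
      refine ⟨if a = c then c + 1 else c, fun x => ?_⟩
      rw [hB]
      split_ifs <;> omega
    · exact hlow i h1 h2 h3

/-! ### Representatives of the two fixed classes. -/

/-- The one-line notation of a permutation. -/
def permWord {n : ℕ} (σ : Equiv.Perm (Fin n)) : Word := List.ofFn fun k => Nat.succPNat (σ k)

theorem isPermutation_permWord {n : ℕ} (σ : Equiv.Perm (Fin n)) :
    IsPermutation n (permWord σ) := by
  constructor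
  · refine List.nodup_ofFn.2 fun a b h => σ.injective (Fin.ext ?_)
    exact Nat.succPNat_injective h
  · intro a
    rw [permWord, List.mem_ofFn]
    constructor
    · rintro ⟨k, rfl⟩
      rw [Nat.succPNat_coe]
      exact (σ k).2
    · intro h
      have := a.pos
      refine ⟨σ.symm ⟨a - 1, by omega⟩, PNat.coe_injective ?_⟩
      rw [Equiv.apply_symm_apply, Nat.succPNat_coe]
      exact Nat.succ_pred_eq_of_pos a.pos

theorem column_permWord {n : ℕ} (σ : Equiv.Perm (Fin n)) (k : Fin n) :
    column (permWord σ) (k : ℕ) = σ k + 1 := by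
  rw [column_getElem _ _ (by simp [permWord])]
  simp [permWord]

theorem straight_permWord (n : ℕ) : Straight n (permWord (1 : Equiv.Perm (Fin n))) := by
  have hp := isPermutation_permWord (1 : Equiv.Perm (Fin n))
  refine ⟨hp.column_le, fun i h1 h2 => ⟨i - 1, fun x => ?_⟩⟩
  have hx := column_pos_iff (permWord (1 : Equiv.Perm (Fin n))) x
  rw [hp.length_eq] at hx
  by_cases h : 0 ≤ x ∧ x < n
  · obtain ⟨h0, h3⟩ := h
    lift x to ℕ using h0
    have := column_permWord (n := n) 1 ⟨x, by omega⟩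
    simp only [Equiv.Perm.one_apply] at this
    omega
  · omega

/-- With `n = m + 3`, this is the increasing word with `n - 2` and `n - 1` exchanged, so that `n -
2` separates the two largest letters. -/
theorem gapped_permWord (m : ℕ) : Gapped (m + 3)
    (permWord (Equiv.swap (⟨m, by omega⟩ : Fin (m + 3)) ⟨m + 1, by omega⟩)) := by
  obtain ⟨σ, hσ⟩ : ∃ σ, σ = Equiv.swap (⟨m, by omega⟩ : Fin (m + 3)) ⟨m + 1, by omega⟩ := ⟨_, rfl⟩
  rw [← hσ]
  have hp := isPermutation_permWord σ
  have hcol : ∀ x : ℤ, 0 ≤ x → x < m + 3 → (column (permWord σ) x : ℤ) =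
      if x = m then (m + 2 : ℤ) else if x = m + 1 then (m + 1 : ℤ) else x + 1 := by
    intro x h0 h3
    lift x to ℕ using h0
    have := column_permWord σ ⟨x, by omega⟩
    rw [hσ, Equiv.swap_apply_def, ← hσ] at this
    simp only [Fin.mk.injEq] at this
    rw [this]
    split_ifs <;> push_cast <;> omega
  have hpos : ∀ x, 0 < column (permWord σ) x ↔ 0 ≤ x ∧ x < m + 3 := fun x => by
    have := column_pos_iff (permWord σ) x
    rw [hp.length_eq] at this
    exact_mod_cast this
  refine ⟨hp.column_le, fun i h1 h2 h4 => ⟨i - 1, fun x => ?_⟩, m, fun x => ?_⟩ <;>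
  · have h5 := hcol x
    have h6 := hpos x
    split_ifs at h5 <;> push_cast <;> omega

/-! ### Counting orbits of the reversal. -/

/-- Each fibre `{x, σ x}` has two elements and no fixed point, or one element that is fixed. Either
way its size plus its number of fixed points is two. -/
theorem card_add_two_eq_two_mul_card {X Q : Type*} [Finite X] [Finite Q] {π : X → Q}
    (hπ : Function.Surjective π) {σ : X → X} (h : ∀ x y, π x = π y ↔ y = x ∨ y = σ x) {a b : X}
    (hab : a ≠ b) (hfix : ∀ x, σ x = x ↔ x = a ∨ x = b) : Nat.card X + 2 = 2 * Nat.card Q := by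
  classical
  have := Fintype.ofFinite X
  have := Fintype.ofFinite Q
  rw [Nat.card_eq_fintype_card, Nat.card_eq_fintype_card, ← Finset.card_univ, ← Finset.card_univ]
  suffices e : (Finset.univ : Finset X).card + ({a, b} : Finset X).card =
      (Finset.univ : Finset Q).card * 2 by rwa [Finset.card_pair hab, mul_comm] at e
  rw [Finset.card_eq_sum_card_fiberwise (f := π) (t := Finset.univ) (fun _ _ => by simp),
    Finset.card_eq_sum_card_fiberwise (s := {a, b}) (f := π) (t := Finset.univ)
      (fun _ _ => by simp), ← Finset.sum_add_distrib]
  refine Finset.sum_const_nat fun q _ => ?_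
  obtain ⟨x, rfl⟩ := hπ q
  have e : (Finset.univ.filter fun y => π y = π x) = {x, σ x} := by
    ext y
    simp [eq_comm, h x y]
  rw [e]
  by_cases hx : σ x = x
  · have e' : (({a, b} : Finset X).filter fun y => π y = π x) = {x} := by
      ext y
      simp only [Finset.mem_filter, Finset.mem_insert, Finset.mem_singleton, ← hfix, h]
      constructor
      · rintro ⟨hy, h | h⟩
        · exact h.symm
        · exact (h.trans hy).symm
      · rintro rfl
        exact ⟨hx, Or.inl rfl⟩
    rw [e', hx]
    simp
  · have e' : (({a, b} : Finset X).filter fun y => π y = π x) = ∅ := by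
      ext y
      simp only [Finset.mem_filter, Finset.mem_insert, Finset.mem_singleton, ← hfix, h,
        Finset.notMem_empty, iff_false, not_and]
      rintro hy (rfl | h')
      · exact hx hy
      · rw [hy] at h'
        exact hx (h' ▸ hy)
    rw [e', Finset.card_pair (Ne.symm hx)]
    simp

end WilfShift

open WilfShift in
theorem corollary5p6 (n : ℕ) (hn : 3 ≤ n) :
    (WilfShift.numShiftClasses n : ℚ) = 1 + (WilfShift.numSSWilfClasses n : ℚ) / 2 := by
  have hr : ∀ u v : PermWord n, (ssWilfSetoid n).r u v ↔ LevelEquiv u.1 v.1 := fun u v =>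
    u.2.ssWilf_iff (by omega) v.2
  have hs : ∀ u v : PermWord n, (shiftSetoid n).r u v ↔
      LevelEquiv u.1 v.1 ∨ LevelEquiv u.1.reverse v.1 := fun u v =>
    shiftEquiv_iff (u.2.length_eq.trans v.2.length_eq.symm)
  let ρ : PermWord n → PermWord n := fun u => ⟨u.1.reverse, u.2.reverse⟩
  have hp := straight_permWord n
  obtain ⟨p, hp⟩ : ∃ p : PermWord n, Straight n p.1 := ⟨⟨_, isPermutation_permWord _⟩, hp⟩
  obtain ⟨q, hq⟩ : ∃ q : PermWord n, Gapped n q.1 := by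
    obtain ⟨m, rfl⟩ := Nat.exists_eq_add_of_le' hn
    exact ⟨⟨_, isPermutation_permWord _⟩, gapped_permWord m⟩
  have key : Nat.card (Quotient (ssWilfSetoid n)) + 2 = 2 * Nat.card (Quotient (shiftSetoid n)) := by
    refine card_add_two_eq_two_mul_card
      (π := Quotient.map' (s₁ := ssWilfSetoid n) (s₂ := shiftSetoid n) id
        fun u v h => (hs u v).2 (Or.inl ((hr u v).1 h)))
      (σ := Quotient.map' (s₁ := ssWilfSetoid n) (s₂ := ssWilfSetoid n) ρ
        fun u v h => (hr _ _).2 ((hr u v).1 h).reverse)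
      (a := Quotient.mk _ p) (b := Quotient.mk _ q) ?_ ?_ ?_ ?_
    · rintro ⟨u⟩
      exact ⟨Quotient.mk _ u, rfl⟩
    · rintro ⟨u⟩ ⟨v⟩
      refine Quotient.eq.trans ((hs u v).trans ?_)
      refine or_congr ?_ ?_
      · exact ⟨fun h => Quotient.sound ((hr _ _).2 h.symm),
          fun h => ((hr _ _).1 (Quotient.exact h)).symm⟩
      · exact ⟨fun h => Quotient.sound ((hr _ _).2 h.symm),
          fun h => ((hr _ _).1 (Quotient.exact h)).symm⟩
    · exact fun h => hp.not_levelEquiv (by omega) hq ((hr _ _).1 (Quotient.exact h))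
    · rintro ⟨u⟩
      constructor
      · intro h
        have h' := ((hr _ _).1 (Quotient.exact h)).symm
        rcases u.2.straight_or_gapped hn h' with e | e
        · exact Or.inl (Quotient.sound ((hr _ _).2 (e.levelEquiv hp)))
        · exact Or.inr (Quotient.sound ((hr _ _).2 (e.levelEquiv hq)))
      -- Both shapes are closed under reversal, and words of one shape are level equivalent. So the
      -- classes of `p` and `q` are fixed, and `u` inherits this from either.
      · have aux : ∀ w : PermWord n, LevelEquiv w.1.reverse w.1 → LevelEquiv u.1 w.1 →
            LevelEquiv u.1.reverse u.1 := fun w h1 h2 => (h2.reverse.trans h1).trans h2.symm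
        rintro (h | h)
        · exact Quotient.sound ((hr _ _).2
            (aux p (hp.reverse.levelEquiv hp) ((hr _ _).1 (Quotient.exact h))))
        · exact Quotient.sound ((hr _ _).2
            (aux q (hq.reverse.levelEquiv hq) ((hr _ _).1 (Quotient.exact h))))
  rw [numShiftClasses, numSSWilfClasses]
  have : (Nat.card (Quotient (ssWilfSetoid n)) : ℚ) + 2 =
      2 * Nat.card (Quotient (shiftSetoid n)) := by exact_mod_cast key
  linarith
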